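/- Let $N,T\ge 1$, and let $x_1,\dots,x_T$ be independent random vectors in $\mathbb R^N$ (the returns on $N$ assets in $T$ periods; $x_{it}$ is the $i$-th coordinate of $x_t$), all with the same elliptical distribution, i.e. $x_t$ has the law of $m+AS$, where $S$ is a random vector in some $\mathbb R^k$ whose law is invariant under orthogonal transformations and $A$ is an $N\times k$ matrix. Assume that the distribution is centred in the sense that all coordinates of the location vector $m$ are equal (for instance $m=0$), and that it is non-degenerate: the dispersion matrix $AA^{\mathrm T}$ is positive definite and $\Pr(x_t=m)=0$. A portfolio $w\in\mathbb R^N$ is normalized if $\sum_i w_i=1$; the normalized counterpart of a portfolio $u$ is the normalized portfolio $u'$ that is parallel to $u$. Given the sample $X=(x_{it})$, a portfolio $u$ strictly dominates a portfolio $v$ if $u$ and $v$ have normalized counterparts $u'$ and $v'$ with $\sum_i u'_i x_{it}\ge\sum_i v'_i x_{it}$ for all $t=1,\dots,T$, with strict inequality for at least one $t$. Then the probability that there exists a pair of portfolios one of which strictly dominates the other on the sample $X$ equals $1-p(N,T)$, where $$p(N,T)=\Theta(T-N)\,\frac{1}{2^{T-1}}\sum_{k=N-1}^{T-1}\binom{T-1}{k},$$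 and $\Theta(x)=1$ for $x\ge 0$, $\Theta(x)=0$ for $x<0$. -/

import Mathlib

open MeasureTheory ProbabilityTheory
open scoped Matrix

/-- The return of the portfolio `w` (one weight per asset) in period `t` on the sample `X`, whose
entry `X i t` is the return on asset `i` in period `t`. -/
def portfolioReturn {N T : ℕ} (X : Matrix (Fin N) (Fin T) ℝ) (w : Fin N → ℝ) (t : Fin T) : ℝ :=
  ∑ i, w i * X i t

/-- A portfolio is normalized if its weights sum to one. -/
def IsNormalized {N : ℕ} (w : Fin N → ℝ) : Prop :=
  ∑ i, w i = 1

/-- `u'` is the normalized counterpart of `u`: it is normalized and parallel to `u`. It is unique,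
and it exists if and only if the weights of `u` do not sum to zero. -/
def IsNormalizedCounterpart {N : ℕ} (u' u : Fin N → ℝ) : Prop :=
  IsNormalized u' ∧ ∃ c : ℝ, c ≠ 0 ∧ u' = c • u

/-- `u` dominates `v` on the sample `X`: the normalized counterpart of `u` never returns less than
that of `v`. -/
def Dominates {N T : ℕ} (X : Matrix (Fin N) (Fin T) ℝ) (u v : Fin N → ℝ) : Prop :=
  ∃ u' v' : Fin N → ℝ, IsNormalizedCounterpart u' u ∧ IsNormalizedCounterpart v' v ∧
    ∀ t, portfolioReturn X v' t ≤ portfolioReturn X u' t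

/-- `u` strictly dominates `v` on the sample `X`: it dominates `v`, and in at least one period the
normalized counterpart of `u` returns more than that of `v`. -/
def StrictlyDominates {N T : ℕ} (X : Matrix (Fin N) (Fin T) ℝ) (u v : Fin N → ℝ) : Prop :=
  Dominates X u v ∧
    ∃ u' v' : Fin N → ℝ, IsNormalizedCounterpart u' u ∧ IsNormalizedCounterpart v' v ∧
      ∃ t, portfolioReturn X v' t < portfolioReturn X u' t

/-- A measure on Euclidean space is spherical if it is invariant under all orthogonal maps. -/
def IsSpherical {k : ℕ} (ν : Measure (EuclideanSpace ℝ (Fin k))) : Prop :=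
  ∀ U : EuclideanSpace ℝ (Fin k) ≃ₗᵢ[ℝ] EuclideanSpace ℝ (Fin k), ν.map U = ν

/-- `ρ` is an elliptical distribution on `ℝᴺ` with location vector `m` and dispersion matrix `D`:
it is the law of `m + A S`, where `S` is a random vector with a spherical distribution (in some
dimension `k`) and `A Aᵀ = D`. No moments are assumed to exist. -/
def IsElliptical {N : ℕ} (ρ : Measure (Fin N → ℝ)) (m : Fin N → ℝ)
    (D : Matrix (Fin N) (Fin N) ℝ) : Prop :=
  ∃ (k : ℕ) (A : Matrix (Fin N) (Fin k) ℝ) (ν : Measure (EuclideanSpace ℝ (Fin k))),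
    IsProbabilityMeasure ν ∧ IsSpherical ν ∧ A * Aᵀ = D ∧
      ρ = ν.map (fun s => m + A *ᵥ s.ofLp)

/-- The step function on the integers. -/
def stepFn (x : ℤ) : ℝ :=
  if 0 ≤ x then 1 else 0

/-- `p(N,T) = Θ(T-N) 2^{-(T-1)} ∑_{k=N-1}^{T-1} C(T-1,k)`, for `N, T ≥ 1`. -/
noncomputable def feasibilityProb (N T : ℕ) : ℝ :=
  stepFn ((T : ℤ) - (N : ℤ)) *
    (1 / 2 ^ (T - 1) * ∑ k ∈ Finset.Icc (N - 1) (T - 1), ((T - 1).choose k : ℝ))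

/-! Differences of normalized portfolios form the zero-sum space, of dimension N-1. A strictly
dominating pair exists iff some zero-sum `d` has nonnegative return in every period and positive
return in one. Since `m` has equal coordinates, these returns do not change when `x_t` is replaced
by `x_t - m`, whose law is symmetric. Spherical laws without an atom at 0 do not charge hyperplanes,
so the T return functionals are almost surely in general position. Then a weakly positive `d` can be
perturbed to a strictly positive one (`InGeneralPosition.exists_forall_pos`), and the number of
realized sign vectors is Schläfli's constant (`InGeneralPosition.ncard_signPatterns`). By symmetry
all 2^T sign vectors are equally likely to be realized, so the all-positive one has probability
`cellCount T (N-1) / 2^T`: Wendel's argument. -/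

/-! ### General position and Schläfli's count -/

/-- A family of linear functionals is in general position if any subfamily with at most `dim W`
members takes arbitrary prescribed values. -/
def InGeneralPosition {ι W : Type*} [AddCommGroup W] [Module ℝ W]
    (f : ι → Module.Dual ℝ W) : Prop :=
  ∀ s : Finset ι, s.card ≤ Module.finrank ℝ W → ∀ c : ι → ℝ, ∃ d, ∀ t ∈ s, f t d = c t

/-- The sign vectors which are strictly realized by a family of linear functionals. -/
def signPatterns {ι W : Type*} [AddCommGroup W] [Module ℝ W]
    (f : ι → Module.Dual ℝ W) : Set (ι → ℤˣ) :=
  {ε | ∃ d, ∀ t, 0 < ((ε t : ℤ) : ℝ) * f t d}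

/-- Schläfli's number of cells cut out by `T` hyperplanes through the origin in general position
in dimension `n`. -/
def cellCount : ℕ → ℕ → ℕ
  | 0, _ => 1
  | _ + 1, 0 => 0
  | T + 1, n + 1 => cellCount T (n + 1) + cellCount T n

theorem exists_pos_forall_add_mul_pos {ι : Type*} [Finite ι] (a b : ι → ℝ)
    (h : ∀ t, 0 < a t ∨ a t = 0 ∧ 0 < b t) : ∃ δ > 0, ∀ t, 0 < a t + δ * b t := by
  have key : ∀ᶠ δ : ℝ in nhdsWithin 0 (Set.Ioi 0), ∀ t, 0 < a t + δ * b t := by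
    rw [Filter.eventually_all]
    intro t
    rcases h t with h | ⟨h, hb⟩
    · have hc : Continuous fun δ : ℝ => a t + δ * b t := by fun_prop
      have := hc.tendsto 0
      simp only [zero_mul, add_zero] at this
      exact (this.mono_left nhdsWithin_le_nhds).eventually (lt_mem_nhds h)
    · filter_upwards [self_mem_nhdsWithin] with δ hδ
      rw [h, zero_add]
      exact mul_pos hδ hb
  obtain ⟨δ, h1, h2⟩ := (key.and self_mem_nhdsWithin).exists
  exact ⟨δ, h2, h1⟩

section

variable {W : Type*} [AddCommGroup W] [Module ℝ W]

/-- At most dim W functionals vanish at `d`, since dim W of them are jointly injective. So some `e`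
makes all of these equal to 1, and a small step from `d` towards `e` keeps the others positive. -/
theorem InGeneralPosition.exists_forall_pos {ι : Type*} [Finite ι] [FiniteDimensional ℝ W]
    {f : ι → Module.Dual ℝ W} (hf : InGeneralPosition f) {d : W} (hd : d ≠ 0)
    (h : ∀ t, 0 ≤ f t d) : ∃ e, ∀ t, 0 < f t e := by
  classical
  have := Fintype.ofFinite ι
  let Z : Finset ι := {t | f t d = 0}
  have hZ : Z.card ≤ Module.finrank ℝ W := by
    by_contra! hlt
    obtain ⟨s, hs, hcard⟩ := Finset.exists_subset_card_eq hlt.le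
    let g : W →ₗ[ℝ] (s → ℝ) := LinearMap.pi fun t => f t
    have hsurj : Function.Surjective g := by
      intro c
      obtain ⟨e, he⟩ := hf s hcard.le (fun t => if ht : t ∈ s then c ⟨t, ht⟩ else 0)
      refine ⟨e, funext fun t => ?_⟩
      simp [g, he t t.2]
    have hinj : Function.Injective g :=
      (LinearMap.injective_iff_surjective_of_finrank_eq_finrank (by simp [hcard])).2 hsurj
    refine hd (hinj ?_)
    ext t
    have := hs t.2
    simpa [g, Z] using this
  obtain ⟨e, he⟩ := hf Z hZ fun _ => 1
  obtain ⟨δ, -, hδ⟩ := exists_pos_forall_add_mul_pos (fun t => f t d) (fun t => f t e) (by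
    intro t
    rcases (h t).lt_or_eq with h | h
    · exact Or.inl h
    · exact Or.inr ⟨h.symm, by rw [he t (by simp [Z, h.symm])]; exact one_pos⟩)
  exact ⟨d + δ • e, fun t => by simpa using hδ t⟩

theorem InGeneralPosition.tail {T : ℕ} {f : Fin (T + 1) → Module.Dual ℝ W}
    (hf : InGeneralPosition f) : InGeneralPosition (Fin.tail f) := by
  intro s hs c
  obtain ⟨d, hd⟩ := hf (s.map (Fin.succEmb T)) (by simpa using hs) (Fin.cons 0 c)
  exact ⟨d, fun t ht => by simpa [Fin.tail] using hd t.succ (by simpa using ht)⟩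

theorem InGeneralPosition.restrict_ker {T n : ℕ} {f : Fin (T + 1) → Module.Dual ℝ W}
    (hf : InGeneralPosition f) (hn : Module.finrank ℝ W = n + 1)
    (hk : Module.finrank ℝ (LinearMap.ker (f 0)) = n) :
    InGeneralPosition fun t => (Fin.tail f t).domRestrict (LinearMap.ker (f 0)) := by
  intro s hs c
  obtain ⟨d, hd⟩ := hf (Finset.cons 0 (s.map (Fin.succEmb T)) (by simp))
    (by simp [hn]; omega) (Fin.cons 0 c)
  refine ⟨⟨d, ?_⟩, fun t ht => ?_⟩
  · simpa using hd 0 (by simp)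
  · simpa [Fin.tail] using hd t.succ (by simp [ht])

theorem signPatterns_eq_union {T : ℕ} (f : Fin (T + 1) → Module.Dual ℝ W) :
    signPatterns f =
      (Fin.cons (α := fun _ => ℤˣ) 1) ''
        {ε | ∃ d, 0 < f 0 d ∧ ∀ t, 0 < ((ε t : ℤ) : ℝ) * Fin.tail f t d} ∪
      (Fin.cons (α := fun _ => ℤˣ) (-1)) ''
        {ε | ∃ d, f 0 d < 0 ∧ ∀ t, 0 < ((ε t : ℤ) : ℝ) * Fin.tail f t d} := by
  ext ε
  constructor
  · rintro ⟨d, hd⟩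
    have h0 := hd 0
    rcases Int.units_eq_one_or (ε 0) with h | h
    · refine Or.inl ⟨Fin.tail ε, ⟨d, by simpa [h] using h0, fun t => hd t.succ⟩, ?_⟩
      rw [← h]; exact Fin.cons_self_tail ε
    · refine Or.inr ⟨Fin.tail ε, ⟨d, by simpa [h] using h0, fun t => hd t.succ⟩, ?_⟩
      rw [← h]; exact Fin.cons_self_tail ε
  · rintro (⟨ε, ⟨d, h0, hd⟩, rfl⟩ | ⟨ε, ⟨d, h0, hd⟩, rfl⟩)
    · exact ⟨d, Fin.cases (by simpa using h0) fun t => by simpa [Fin.tail] using hd t⟩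
    · exact ⟨d, Fin.cases (by simpa using h0) fun t => by simpa [Fin.tail] using hd t⟩

end

theorem exists_sides_of_ne_zero {T : ℕ} {W : Type*} [AddCommGroup W] [Module ℝ W]
    {f : Fin T → Module.Dual ℝ W} {g : Module.Dual ℝ W} {e : W} (he : 0 < g e) {ε : Fin T → ℤˣ}
    {d : W} (h0 : g d = 0) (hd : ∀ t, 0 < ((ε t : ℤ) : ℝ) * f t d) :
    ∃ d', 0 < g d' ∧ ∀ t, 0 < ((ε t : ℤ) : ℝ) * f t d' := by
  obtain ⟨δ, hδ, h⟩ := exists_pos_forall_add_mul_pos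
    (fun t => ((ε t : ℤ) : ℝ) * f t d) (fun t => ((ε t : ℤ) : ℝ) * f t e) fun t => Or.inl (hd t)
  refine ⟨d + δ • e, by simpa [h0] using mul_pos hδ he, fun t => ?_⟩
  have := h t
  simp only [map_add, map_smul, smul_eq_mul]
  linarith

/-- Schläfli's count: the number of realized sign vectors of functionals in general position. -/
theorem InGeneralPosition.ncard_signPatterns {T : ℕ} :
    ∀ {W : Type*} [AddCommGroup W] [Module ℝ W] [FiniteDimensional ℝ W]
      {f : Fin T → Module.Dual ℝ W}, InGeneralPosition f →
      (signPatterns f).ncard = cellCount T (Module.finrank ℝ W) := by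
  induction T with
  | zero =>
    intro W _ _ _ f _
    have : signPatterns f = Set.univ := Set.eq_univ_of_forall fun ε => ⟨0, fun t => t.elim0⟩
    simp [this, cellCount, Set.ncard_univ]
  | succ T ih =>
    intro W _ _ _ f hf
    rcases hn : Module.finrank ℝ W with _ | n
    · have : Subsingleton W := Module.finrank_zero_iff.1 hn
      have : signPatterns f = ∅ := Set.eq_empty_of_forall_notMem fun ε ⟨d, hd⟩ => by
        simpa [Subsingleton.elim d 0] using hd 0
      simp [this, cellCount]
    obtain ⟨e, he⟩ := hf {0} (by simp [hn]) 1
    replace he : f 0 e = 1 := by simpa using he 0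
    have hk : Module.finrank ℝ (LinearMap.ker (f 0)) = n := by
      have hsurj : LinearMap.range (f 0) = ⊤ :=
        LinearMap.range_eq_top.2 fun c => ⟨c • e, by simp [he]⟩
      have := LinearMap.finrank_range_add_finrank_ker (f 0)
      rw [hsurj, hn, finrank_top, Module.finrank_self] at this
      omega
    -- Patterns of the other functionals on the two open sides of the hyperplane `f 0 = 0`. Those in
    -- `A ∪ B` are realized anywhere, those in `A ∩ B` on the hyperplane itself; this gives
    -- Schläfli's recursion.
    set A : Set (Fin T → ℤˣ) :=
      {ε | ∃ d, 0 < f 0 d ∧ ∀ t, 0 < ((ε t : ℤ) : ℝ) * Fin.tail f t d} with hA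
    set B : Set (Fin T → ℤˣ) :=
      {ε | ∃ d, f 0 d < 0 ∧ ∀ t, 0 < ((ε t : ℤ) : ℝ) * Fin.tail f t d} with hB
    have hpos : ∀ ε : Fin T → ℤˣ, ∀ d, f 0 d = 0 →
        (∀ t, 0 < ((ε t : ℤ) : ℝ) * Fin.tail f t d) → ε ∈ A := fun ε d h0 hd =>
      exists_sides_of_ne_zero (g := f 0) (e := e) (by simp [he]) h0 hd
    have hneg : ∀ ε : Fin T → ℤˣ, ∀ d, f 0 d = 0 →
        (∀ t, 0 < ((ε t : ℤ) : ℝ) * Fin.tail f t d) → ε ∈ B := fun ε d h0 hd => by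
      obtain ⟨d', h0', hd'⟩ := exists_sides_of_ne_zero (g := -f 0) (e := -e)
        (by simp [he]) (by simp [h0]) hd
      exact ⟨d', by simpa using h0', hd'⟩
    have hunion : A ∪ B = signPatterns (Fin.tail f) := by
      ext ε
      constructor
      · rintro (⟨d, -, hd⟩ | ⟨d, -, hd⟩) <;> exact ⟨d, hd⟩
      · rintro ⟨d, hd⟩
        rcases lt_trichotomy (f 0 d) 0 with h | h | h
        · exact Or.inr ⟨d, h, hd⟩
        · exact Or.inl (hpos ε d h hd)
        · exact Or.inl ⟨d, h, hd⟩
    have hinter : A ∩ B =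
        signPatterns fun t => (Fin.tail f t).domRestrict (LinearMap.ker (f 0)) := by
      ext ε
      constructor
      · rintro ⟨⟨a, ha, ha'⟩, ⟨b, hb, hb'⟩⟩
        -- The positive combination of `a` and `b` that is killed by `f 0`.
        refine ⟨⟨(-f 0 b) • a + f 0 a • b, by simp; ring⟩, fun t => ?_⟩
        have h1 := mul_pos (neg_pos.2 hb) (ha' t)
        have h2 := mul_pos ha (hb' t)
        simp only [LinearMap.domRestrict_apply, map_add, map_smul, smul_eq_mul]
        linarith
      · rintro ⟨⟨d, h0⟩, hd⟩
        exact ⟨hpos ε d h0 hd, hneg ε d h0 hd⟩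
    rw [signPatterns_eq_union f, Set.ncard_union_eq, Set.ncard_image_of_injective,
      Set.ncard_image_of_injective, ← Set.ncard_union_add_ncard_inter A B, hunion, hinter,
      ih hf.tail, ih (hf.restrict_ker hn hk), hn, hk, cellCount]
    · exact Fin.cons_right_injective _
    · exact Fin.cons_right_injective _
    · rw [Set.disjoint_left]
      rintro _ ⟨ε, -, rfl⟩ ⟨ε', -, h⟩
      have := congrFun h 0
      simp at this

theorem cellCount_succ_eq (T n : ℕ) :
    cellCount (T + 1) n = 2 * ∑ k ∈ Finset.range n, T.choose k := by
  induction T generalizing n with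
  | zero =>
    cases n with
    | zero => simp [cellCount]
    | succ n => simp [cellCount, Finset.sum_range_succ']
  | succ T ih =>
    cases n with
    | zero => simp [cellCount]
    | succ n =>
      rw [cellCount, ih, ih, Finset.sum_range_succ' (fun k => (T + 1).choose k)]
      simp only [Nat.choose_succ_succ, Finset.sum_add_distrib]
      rw [Finset.sum_range_succ' (fun k => T.choose k)]
      simp
      ring

/-- The binomial sums below and from n = N-1 on add up to 2^T; if T < n the first is already the
full sum. -/
theorem one_sub_feasibilityProb (n T : ℕ) :
    1 - feasibilityProb (n + 1) (T + 1) = cellCount (T + 1) n / 2 ^ (T + 1) := by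
  have hsum : ∑ k ∈ Finset.range (T + 1), (T.choose k : ℝ) = 2 ^ T := by
    exact_mod_cast Nat.sum_range_choose T
  rw [cellCount_succ_eq, feasibilityProb, stepFn]
  simp only [Nat.add_sub_cancel]
  push_cast
  have h2 : (2 : ℝ) ^ T ≠ 0 := by positivity
  split_ifs with h
  · have : Finset.Icc n T = Finset.Ico n (T + 1) := by ext; simp
    rw [this]
    have hs := Finset.sum_range_add_sum_Ico (fun k => (T.choose k : ℝ)) (m := n) (n := T + 1)
      (by omega)
    rw [hsum] at hs
    field_simp
    rw [pow_succ]
    linear_combination (-2) * 2 ^ T * hs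
  · have : ∑ k ∈ Finset.range n, (T.choose k : ℝ) = 2 ^ T := by
      rw [← hsum]
      refine (Finset.sum_subset ?_ ?_).symm
      · intro k; simp; omega
      · intro k _ hk
        rw [Nat.choose_eq_zero_of_lt (by simpa using hk)]; simp
    rw [this]
    field_simp
    ring

/-! ### Almost sure general position -/

/-- General position says that each small subfamily has a nonzero minor, an open condition; the
resulting measurability is what Fubini needs. -/
theorem isOpen_setOf_inGeneralPosition {ι E W : Type*} [Finite ι] [TopologicalSpace E]
    [AddCommGroup W] [Module ℝ W] (B : E → Module.Dual ℝ W)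
    (hB : ∀ d, Continuous fun y => B y d) :
    IsOpen {X : ι → E | InGeneralPosition fun t => B (X t)} := by
  classical
  have key : {X : ι → E | InGeneralPosition fun t => B (X t)} =
      ⋂ s : {s : Finset ι // s.card ≤ Module.finrank ℝ W}, ⋃ D : s.1 → W,
        {X | (Matrix.of fun i j : s.1 => B (X i) (D j)).det ≠ 0} := by
    ext X
    simp only [Set.mem_ofPred_eq, Set.mem_iInter, Set.mem_iUnion, Subtype.forall]
    refine forall_congr' fun s => forall_congr' fun hs => ⟨fun h => ?_, fun h c => ?_⟩
    · choose D hD using fun j : s => h (Pi.single (j : ι) 1)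
      refine ⟨D, ?_⟩
      have : (Matrix.of fun i j : s => B (X i) (D j)) = 1 := by
        ext i j
        rw [Matrix.of_apply, hD j i i.2, Matrix.one_apply, Pi.single_apply]
        exact if_congr Subtype.ext_iff.symm rfl rfl
      simp [this]
    · obtain ⟨D, hD⟩ := h
      set M := Matrix.of fun i j : s => B (X i) (D j) with hM
      have hu : IsUnit M.det := isUnit_iff_ne_zero.2 hD
      refine ⟨∑ j, (M⁻¹ *ᵥ fun t : s => c t) j • D j, fun t ht => ?_⟩
      have hmul : M *ᵥ (M⁻¹ *ᵥ fun t : s => c t) = fun t : s => c t := by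
        rw [Matrix.mulVec_mulVec, Matrix.mul_nonsing_inv _ hu, Matrix.one_mulVec]
      rw [← congrFun hmul ⟨t, ht⟩, Matrix.mulVec, dotProduct, map_sum]
      simp [hM, mul_comm]
  rw [key]
  refine isOpen_iInter_of_finite fun s => isOpen_iUnion fun D => ?_
  refine isOpen_ne_fun (Continuous.matrix_det ?_) continuous_const
  exact continuous_matrix fun i j => (hB _).comp (continuous_apply _)

theorem InGeneralPosition.cons {T : ℕ} {W : Type*} [AddCommGroup W] [Module ℝ W]
    {f : Fin T → Module.Dual ℝ W} (hf : InGeneralPosition f) {g : Module.Dual ℝ W}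
    (hg : ∀ s : Finset (Fin T), s.card < Module.finrank ℝ W →
      ∃ d, (∀ t ∈ s, f t d = 0) ∧ g d ≠ 0) :
    InGeneralPosition (Fin.cons g f : Fin (T + 1) → Module.Dual ℝ W) := by
  intro s hs c
  let s' : Finset (Fin T) := {t | t.succ ∈ s}
  have hsub : s'.map (Fin.succEmb T) ⊆ s.erase 0 := by
    intro i hi
    obtain ⟨t, ht, rfl⟩ := Finset.mem_map.1 hi
    simpa [s'] using ht
  have hcard := Finset.card_le_card hsub
  rw [Finset.card_map] at hcard
  obtain ⟨d, hd⟩ := hf s' (hcard.trans ((Finset.card_erase_le).trans hs)) (Fin.tail c)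
  by_cases h0 : (0 : Fin (T + 1)) ∈ s
  · have hpos := Finset.card_pos.2 ⟨_, h0⟩
    rw [Finset.card_erase_of_mem h0] at hcard
    obtain ⟨e, he, hge⟩ := hg s' (by omega)
    refine ⟨d + ((c 0 - g d) / g e) • e, Fin.cases (fun _ => ?_) fun t ht => ?_⟩
    · simp [hge]
    · have ht' : t ∈ s' := by simpa [s'] using ht
      simp [he t ht', hd t ht', Fin.tail]
  · refine ⟨d, Fin.cases (fun h => absurd h h0) fun t ht => ?_⟩
    simpa [Fin.tail] using hd t (by simpa [s'] using ht)

theorem exists_ne_zero_forall_eq_zero {ι W : Type*} [AddCommGroup W] [Module ℝ W]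
    [FiniteDimensional ℝ W] (f : ι → Module.Dual ℝ W) (s : Finset ι)
    (hs : s.card < Module.finrank ℝ W) : ∃ d ≠ 0, ∀ t ∈ s, f t d = 0 := by
  let g : W →ₗ[ℝ] (s → ℝ) := LinearMap.pi fun t => f t
  obtain ⟨d, hd, hne⟩ := (LinearMap.ker g).exists_mem_ne_zero_of_ne_bot
    (LinearMap.ker_ne_bot_of_finrank_lt (by simpa using hs))
  exact ⟨d, hne, fun t ht => congrFun (LinearMap.mem_ker.1 hd) ⟨t, ht⟩⟩

theorem ae_inGeneralPosition {E W : Type*} [TopologicalSpace E] [SecondCountableTopology E]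
    [MeasurableSpace E] [BorelSpace E] [AddCommGroup W] [Module ℝ W] [FiniteDimensional ℝ W]
    {B : E → Module.Dual ℝ W} (hB : ∀ d, Continuous fun y => B y d) (ρ : Measure E)
    [IsProbabilityMeasure ρ] (hρ : ∀ d ≠ 0, ∀ᵐ y ∂ρ, B y d ≠ 0) (T : ℕ) :
    ∀ᵐ X ∂Measure.pi fun _ : Fin T => ρ, InGeneralPosition fun t => B (X t) := by
  induction T with
  | zero =>
    exact Filter.Eventually.of_forall fun X s _ c => ⟨0, fun t => t.elim0⟩
  | succ T ih =>
    have hmp := (measurePreserving_piFinSuccAbove (fun _ : Fin (T + 1) => ρ) 0).symm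
    have hmeas : MeasurableSet {X : Fin (T + 1) → E | InGeneralPosition fun t => B (X t)} :=
      (isOpen_setOf_inGeneralPosition B hB).measurableSet
    rw [← hmp.map_eq, ae_map_iff hmp.measurable.aemeasurable hmeas]
    refine (Measure.ae_prod_iff_ae_ae (hmp.measurable hmeas)).2 ?_
    refine (Measure.ae_ae_comm (p := fun y X => InGeneralPosition fun t =>
      B ((MeasurableEquiv.piFinSuccAbove (fun _ : Fin (T + 1) => E) 0).symm (y, X) t))
      (hmp.measurable hmeas)).2 ?_
    filter_upwards [ih] with X hX
    -- The vectors depend only on the earlier draws `X`, so the new draw `y` has to avoid finitely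
    -- many null events.
    choose! d hd0 hd using exists_ne_zero_forall_eq_zero fun t => B (X t)
    have : ∀ᵐ y ∂ρ, ∀ s : Finset (Fin T), s.card < Module.finrank ℝ W → B y (d s) ≠ 0 :=
      ae_all_iff.2 fun s => by
        by_cases hs : s.card < Module.finrank ℝ W
        · filter_upwards [hρ _ (hd0 s hs)] with y hy _ using hy
        · exact Filter.Eventually.of_forall fun y h => absurd h hs
    filter_upwards [this] with y hy
    have := hX.cons (g := B y) fun s hs => ⟨d s, hd s hs, hy s hs⟩
    convert this using 1
    funext t
    refine Fin.cases ?_ (fun t => ?_) t <;> simp [MeasurableEquiv.piFinSuccAbove, Fin.insertNthEquiv]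

/-! ### Spherical and elliptical laws -/

/-- A reflection takes `a`, rescaled to the length of `b`, to `b`. -/
theorem IsSpherical.measure_orthogonal_eq {k : ℕ} {ν : Measure (EuclideanSpace ℝ (Fin k))}
    (hν : IsSpherical ν) {a b : EuclideanSpace ℝ (Fin k)} (ha : a ≠ 0) (hb : b ≠ 0) :
    ν {s | inner ℝ a s = 0} = ν {s | inner ℝ b s = 0} := by
  have ha' : ‖a‖ ≠ 0 := norm_ne_zero_iff.2 ha
  have hb' : ‖b‖ ≠ 0 := norm_ne_zero_iff.2 hb
  have hnorm : ‖(‖b‖ / ‖a‖) • a‖ = ‖b‖ := by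
    rw [norm_smul, norm_div, norm_norm, norm_norm, div_mul_cancel₀ _ ha']
  let U := (ℝ ∙ ((‖b‖ / ‖a‖) • a - b))ᗮ.reflection
  have hU : U ((‖b‖ / ‖a‖) • a) = b := Submodule.reflection_sub hnorm
  have hset : {s | inner ℝ a s = 0} = U ⁻¹' {s | inner ℝ b s = 0} := by
    ext s
    simp only [Set.mem_ofPred_eq, Set.mem_preimage]
    rw [← hU, LinearIsometryEquiv.inner_map_map, real_inner_smul_left]
    simp [ha', hb']
  rw [hset, ← Measure.map_apply U.continuous.measurable, hν U]
  exact (isClosed_eq (by fun_prop) (by fun_prop)).measurableSet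

/-- Vandermonde: any k distinct points of the moment curve are linearly independent. -/
theorem card_filter_moment_lt {k : ℕ} {s : EuclideanSpace ℝ (Fin k)} (hs : s ≠ 0)
    (J : Finset ℕ) (hJ : ∀ j ∈ J, ∑ i : Fin k, (j : ℝ) ^ (i : ℕ) * s i = 0) : J.card < k := by
  by_contra! h
  obtain ⟨J', hsub, hcard⟩ := Finset.exists_subset_card_eq h
  let e := J'.equivFinOfCardEq hcard
  have := Matrix.eq_zero_of_forall_index_sum_pow_mul_eq_zero
    (f := fun j : Fin k => ((e.symm j : ℕ) : ℝ)) (v := fun i => s i)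
    (fun i j hij => e.symm.injective (Subtype.ext (Nat.cast_injective hij)))
    (fun j => hJ _ (hsub (e.symm j).2))
  exact hs (by ext i; exact congrFun this i)

/-- All hyperplanes have equal mass, and a nonzero point lies on fewer than k of those orthogonal to
the moment curve. Hence M times this mass is at most k for every M. -/
theorem IsSpherical.measure_orthogonal_eq_zero {k : ℕ} {ν : Measure (EuclideanSpace ℝ (Fin k))}
    [IsProbabilityMeasure ν] (hν : IsSpherical ν) (h0 : ν {0} = 0)
    {a : EuclideanSpace ℝ (Fin k)} (ha : a ≠ 0) : ν {s | inner ℝ a s = 0} = 0 := by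
  classical
  have hk : 0 < k := by
    rcases Nat.eq_zero_or_pos k with rfl | h
    · exact absurd (Subsingleton.elim a 0) ha
    · exact h
  let u : ℕ → EuclideanSpace ℝ (Fin k) := fun j => WithLp.toLp 2 fun i => (j : ℝ) ^ (i : ℕ)
  have hu : ∀ j, u j ≠ 0 := fun j h => by
    have := congrArg (fun v : EuclideanSpace ℝ (Fin k) => v ⟨0, hk⟩) h
    simp [u] at this
  have hinner : ∀ j s, inner ℝ (u j) s = ∑ i : Fin k, (j : ℝ) ^ (i : ℕ) * s i := by
    intro j s
    simp [u, PiLp.inner_apply, mul_comm]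
  have hmeas : ∀ j, MeasurableSet {s | inner ℝ (u j) s = 0} := fun j =>
    (isClosed_eq (by fun_prop) (by fun_prop)).measurableSet
  have hbound : ∀ M : ℕ, (M : ENNReal) * ν {s | inner ℝ a s = 0} ≤ k := by
    intro M
    calc (M : ENNReal) * ν {s | inner ℝ a s = 0}
        = ∑ j ∈ Finset.range M, ν {s | inner ℝ (u j) s = 0} := by
          rw [Finset.sum_congr rfl fun j _ => hν.measure_orthogonal_eq (hu j) ha]
          simp
      _ = ∫⁻ s, ∑ j ∈ Finset.range M, {s | inner ℝ (u j) s = 0}.indicator 1 s ∂ν := by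
          rw [lintegral_finsetSum _ fun j _ => measurable_one.indicator (hmeas j)]
          exact Finset.sum_congr rfl fun j _ => (lintegral_indicator_one (hmeas j)).symm
      _ ≤ ∫⁻ _, k ∂ν := by
          refine lintegral_mono_ae ?_
          have hne : ∀ᵐ s ∂ν, s ≠ 0 := by
            rw [ae_iff]; simpa using h0
          filter_upwards [hne] with s hs
          have := card_filter_moment_lt hs
            ((Finset.range M).filter fun j => inner ℝ (u j) s = 0) fun j hj => by
              rw [← hinner]; exact (Finset.mem_filter.1 hj).2
          simp only [Set.indicator_apply, Set.mem_ofPred_eq, Pi.one_apply, Finset.sum_boole]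
          exact_mod_cast this.le
      _ = k := by simp
  by_contra hne
  obtain ⟨M, hM⟩ := ENNReal.exists_nat_mul_gt hne (ENNReal.natCast_ne_top k)
  exact absurd (hbound M) (not_le.2 hM)

section

variable {N : ℕ} {ρ : Measure (Fin N → ℝ)} {m : Fin N → ℝ} {D : Matrix (Fin N) (Fin N) ℝ}

theorem continuous_affine_mulVec {k : ℕ} (m : Fin N → ℝ) (A : Matrix (Fin N) (Fin k) ℝ) :
    Continuous fun s : EuclideanSpace ℝ (Fin k) => m + A *ᵥ s.ofLp :=
  continuous_const.add (Continuous.matrix_mulVec continuous_const (PiLp.continuous_ofLp 2 _))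

theorem IsElliptical.isProbabilityMeasure (h : IsElliptical ρ m D) : IsProbabilityMeasure ρ := by
  obtain ⟨k, A, ν, hν, -, -, rfl⟩ := h
  exact Measure.isProbabilityMeasure_map (continuous_affine_mulVec m A).measurable.aemeasurable

theorem IsElliptical.measurePreserving_reflection (h : IsElliptical ρ m D) :
    MeasurePreserving (fun y => m - (y - m)) ρ ρ := by
  obtain ⟨k, A, ν, hν, hsph, -, rfl⟩ := h
  have hc := (continuous_affine_mulVec m A).measurable
  have hr : Measurable fun y : Fin N → ℝ => m - (y - m) := by fun_prop
  refine ⟨hr, ?_⟩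
  conv_rhs => rw [← hsph (LinearIsometryEquiv.neg ℝ)]
  rw [Measure.map_map hr hc, Measure.map_map hc (LinearIsometryEquiv.continuous _).measurable]
  congr 1
  funext s
  simp [Matrix.mulVec_neg, sub_eq_add_neg]

theorem IsElliptical.ae_dotProduct_ne_zero (h : IsElliptical ρ m D) (hD : D.PosDef)
    (hatom : ρ {m} = 0) {d : Fin N → ℝ} (hd : d ≠ 0) : ∀ᵐ y ∂ρ, d ⬝ᵥ (y - m) ≠ 0 := by
  obtain ⟨k, A, ν, hν, hsph, rfl, rfl⟩ := h
  have hc := (continuous_affine_mulVec m A).measurable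
  have h0 : ν {0} = 0 := by
    rw [Measure.map_apply hc (measurableSet_singleton m)] at hatom
    exact measure_mono_null (fun s hs => by
      rw [Set.mem_singleton_iff] at hs
      simp [hs]) hatom
  have ha : WithLp.toLp 2 (d ᵥ* A) ≠ (0 : EuclideanSpace ℝ (Fin k)) := by
    intro h
    have h' : d ᵥ* A = 0 := congrArg WithLp.ofLp h
    -- The quadratic form of A Aᵀ at `d` is the squared length of Aᵀ d.
    have := hD.dotProduct_mulVec_pos hd
    rw [← Matrix.mulVec_mulVec, Matrix.dotProduct_mulVec] at this
    simp [h'] at this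
  rw [ae_map_iff hc.aemeasurable
    (isOpen_ne_fun (by fun_prop) continuous_const).measurableSet, ae_iff]
  refine measure_mono_null (fun s hs => ?_) (hsph.measure_orthogonal_eq_zero h0 ha)
  simp only [ne_eq, not_not, Set.mem_ofPred_eq, add_sub_cancel_left,
    Matrix.dotProduct_mulVec] at hs
  simp only [Set.mem_ofPred_eq, EuclideanSpace.inner_eq_star_dotProduct, star_trivial]
  rw [dotProduct_comm]; exact hs

end

/-! ### Wendel's theorem -/

/-- Wendel's theorem for independent copies of a symmetric random functional. -/
theorem two_pow_mul_measure_exists_forall_pos {E W : Type*} [TopologicalSpace E]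
    [SecondCountableTopology E] [MeasurableSpace E] [BorelSpace E] [AddCommGroup W] [Module ℝ W]
    [FiniteDimensional ℝ W] {B : E → Module.Dual ℝ W} (hB : ∀ d, Continuous fun y => B y d)
    (ρ : Measure E) [IsProbabilityMeasure ρ] {R : E → E} (hR : MeasurePreserving R ρ ρ)
    (hBR : ∀ y, B (R y) = -B y) (T : ℕ)
    (hGP : ∀ᵐ X ∂Measure.pi fun _ : Fin T => ρ, InGeneralPosition fun t => B (X t)) :
    2 ^ T * (Measure.pi fun _ : Fin T => ρ) {X | ∃ d, ∀ t, 0 < B (X t) d} =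
      cellCount T (Module.finrank ℝ W) := by
  classical
  set μ := Measure.pi fun _ : Fin T => ρ with hμ
  -- Reflecting the draws with sign -1 preserves the product law and turns realizing `ε` into
  -- realizing all plus signs.
  let S : (Fin T → ℤˣ) → (Fin T → E) → Fin T → E := fun ε X t => if ε t = 1 then X t else R (X t)
  have hS : ∀ ε, MeasurePreserving (S ε) μ μ := fun ε =>
    measurePreserving_pi (f := fun t y => if ε t = 1 then y else R y) _ _ fun t => by
      by_cases h : ε t = 1
      · simp only [h, if_true]; exact MeasurePreserving.id ρ
      · simpa [h] using hR
  have hmeas : MeasurableSet {X : Fin T → E | ∃ d, ∀ t, 0 < B (X t) d} := by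
    simp only [Set.ofPred_exists, Set.ofPred_forall]
    exact (isOpen_iUnion fun d => isOpen_iInter_of_finite fun t =>
      isOpen_lt continuous_const ((hB d).comp (continuous_apply t))).measurableSet
  have hmem : ∀ ε X, X ∈ S ε ⁻¹' {X | ∃ d, ∀ t, 0 < B (X t) d} ↔
      ε ∈ signPatterns fun t => B (X t) := by
    intro ε X
    refine exists_congr fun d => forall_congr' fun t => ?_
    rcases Int.units_eq_one_or (ε t) with h | h <;> simp [S, h, hBR]
  calc 2 ^ T * μ {X | ∃ d, ∀ t, 0 < B (X t) d}
      = ∑ ε : Fin T → ℤˣ, μ (S ε ⁻¹' {X | ∃ d, ∀ t, 0 < B (X t) d}) := by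
        rw [Finset.sum_congr rfl fun ε _ => (hS ε).measure_preimage hmeas.nullMeasurableSet]
        simp
    _ = ∫⁻ X, ∑ ε : Fin T → ℤˣ,
          (S ε ⁻¹' {X | ∃ d, ∀ t, 0 < B (X t) d}).indicator 1 X ∂μ := by
        rw [lintegral_finsetSum _ fun ε _ =>
          measurable_one.indicator ((hS ε).measurable hmeas)]
        exact Finset.sum_congr rfl fun ε _ =>
          (lintegral_indicator_one ((hS ε).measurable hmeas)).symm
    _ = ∫⁻ _, (cellCount T (Module.finrank ℝ W) : ENNReal) ∂μ := by
        refine lintegral_congr_ae ?_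
        filter_upwards [hGP] with X hX
        rw [← hX.ncard_signPatterns]
        simp only [Set.indicator_apply, hmem, Pi.one_apply, Finset.sum_boole]
        rw [Set.ncard_eq_toFinset_card']
        congr 2
        ext ε
        simp
    _ = cellCount T (Module.finrank ℝ W) := by simp

/-! ### Portfolios and dominance -/

/-- The differences of normalized portfolios. -/
def zeroSum (N : ℕ) : Submodule ℝ (Fin N → ℝ) :=
  LinearMap.ker (∑ i, LinearMap.proj i : (Fin N → ℝ) →ₗ[ℝ] ℝ)

theorem mem_zeroSum {N : ℕ} {d : Fin N → ℝ} : d ∈ zeroSum N ↔ ∑ i, d i = 0 := by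
  simp [zeroSum]

theorem finrank_zeroSum (n : ℕ) : Module.finrank ℝ (zeroSum (n + 1)) = n := by
  set g : (Fin (n + 1) → ℝ) →ₗ[ℝ] ℝ := ∑ i, LinearMap.proj i with hg
  have hsurj : LinearMap.range g = ⊤ :=
    LinearMap.range_eq_top.2 fun c => ⟨Pi.single 0 c, by simp [hg]⟩
  have := LinearMap.finrank_range_add_finrank_ker g
  rw [hsurj, finrank_top, Module.finrank_self, Module.finrank_fin_fun] at this
  change Module.finrank ℝ (LinearMap.ker g) = n
  omega

/-- The return of a zero-sum portfolio as a linear functional of its weights, for asset returns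
`y` measured relative to `m`. -/
def zeroSumReturn {N : ℕ} (m y : Fin N → ℝ) : Module.Dual ℝ (zeroSum N) where
  toFun d := d.1 ⬝ᵥ (y - m)
  map_add' d e := by simp only [Submodule.coe_add, add_dotProduct]
  map_smul' c d := by simp only [Submodule.coe_smul, smul_dotProduct, RingHom.id_apply]

theorem zeroSumReturn_eq {N : ℕ} {m : Fin N → ℝ} (hm : ∀ i j, m i = m j) (y : Fin N → ℝ)
    (d : zeroSum N) : zeroSumReturn m y d = ∑ i, d.1 i * y i := by
  have h : d.1 ⬝ᵥ m = 0 := by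
    rcases isEmpty_or_nonempty (Fin N) with _ | ⟨⟨i⟩⟩
    · simp [dotProduct]
    · simp_rw [dotProduct, fun j => hm j i, ← Finset.sum_mul, mem_zeroSum.1 d.2, zero_mul]
  change d.1 ⬝ᵥ (y - m) = _
  rw [dotProduct_sub, h, sub_zero, dotProduct]

theorem IsNormalizedCounterpart.unique {N : ℕ} {u u' u'' : Fin N → ℝ}
    (h' : IsNormalizedCounterpart u' u) (h'' : IsNormalizedCounterpart u'' u) : u' = u'' := by
  obtain ⟨h1, c, -, rfl⟩ := h'
  obtain ⟨h2, c', -, rfl⟩ := h''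
  simp only [IsNormalized, Pi.smul_apply, smul_eq_mul, ← Finset.mul_sum] at h1 h2
  have hne : ∑ i, u i ≠ 0 := right_ne_zero_of_mul_eq_one h1
  rw [mul_right_cancel₀ hne (h1.trans h2.symm)]

theorem exists_strictlyDominates_iff {N T : ℕ} (hN : 1 ≤ N) {m : Fin N → ℝ}
    (hm : ∀ i j, m i = m j) (X : Fin T → Fin N → ℝ) :
    (∃ u v : Fin N → ℝ, StrictlyDominates (Matrix.of fun i t => X t i) u v) ↔
      ∃ d : zeroSum N, (∀ t, 0 ≤ zeroSumReturn m (X t) d) ∧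
        ∃ t, 0 < zeroSumReturn m (X t) d := by
  have hdiff : ∀ (d : zeroSum N) (u v : Fin N → ℝ) (_ : d.1 = u - v) t,
      zeroSumReturn m (X t) d = portfolioReturn (Matrix.of fun i t => X t i) u t -
        portfolioReturn (Matrix.of fun i t => X t i) v t := by
    intro d u v h t
    rw [zeroSumReturn_eq hm, h]
    simp [portfolioReturn, sub_mul]
  constructor
  · rintro ⟨u, v, ⟨u', v', hu, hv, hle⟩, u'', v'', hu'', hv'', t, hlt⟩
    obtain rfl := hu.unique hu''
    obtain rfl := hv.unique hv''
    refine ⟨⟨u' - v', mem_zeroSum.2 ?_⟩, fun t => ?_, t, ?_⟩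
    · have h1 : ∑ i, u' i = 1 := hu.1
      have h2 : ∑ i, v' i = 1 := hv.1
      simp [h1, h2]
    · rw [hdiff _ u' v' rfl]; exact sub_nonneg.2 (hle t)
    · rw [hdiff _ u' v' rfl]; exact sub_pos.2 hlt
  · rintro ⟨d, hd, t, ht⟩
    -- Any normalized portfolio would serve as the dominated one.
    let v : Fin N → ℝ := Pi.single ⟨0, hN⟩ 1
    have hv : IsNormalized v := by simp [IsNormalized, v]
    have hu : IsNormalized (d.1 + v) := by
      have h1 : ∑ i, v i = 1 := hv
      simp [IsNormalized, Finset.sum_add_distrib, mem_zeroSum.1 d.2, h1]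
    have hu' : IsNormalizedCounterpart (d.1 + v) (d.1 + v) := ⟨hu, 1, one_ne_zero, by simp⟩
    have hv' : IsNormalizedCounterpart v v := ⟨hv, 1, one_ne_zero, by simp⟩
    have h := hdiff d (d.1 + v) v (by simp)
    refine ⟨d.1 + v, v, ⟨_, _, hu', hv', fun t => ?_⟩, _, _, hu', hv', t, ?_⟩
    · rw [← sub_nonneg, ← h]; exact hd t
    · rw [← sub_pos, ← h]; exact ht

theorem corollary1 {Ω : Type*} [MeasurableSpace Ω] (P : Measure Ω) [IsProbabilityMeasure P]
    (N T : ℕ) (hN : 1 ≤ N) (hT : 1 ≤ T)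
    (ρ : Measure (Fin N → ℝ)) (m : Fin N → ℝ) (D : Matrix (Fin N) (Fin N) ℝ)
    (hρ : IsElliptical ρ m D) (hm : ∀ i j, m i = m j) (hD : D.PosDef) (hatom : ρ {m} = 0)
    (x : Fin T → Ω → Fin N → ℝ) (hlaw : ∀ t, HasLaw (x t) ρ P) (hindep : iIndepFun x P) :
    P.real {ω | ∃ u v : Fin N → ℝ, StrictlyDominates (Matrix.of fun i t => x t ω i) u v} =
      1 - feasibilityProb N T := by
  have hprob := hρ.isProbabilityMeasure
  have hB : ∀ d, Continuous fun y => zeroSumReturn m y d := fun d =>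
    show Continuous fun y => d.1 ⬝ᵥ (y - m) by fun_prop
  have hGP := ae_inGeneralPosition hB ρ
    (fun d hd => hρ.ae_dotProduct_ne_zero hD hatom (Subtype.coe_ne_coe.2 hd)) T
  have hwendel := two_pow_mul_measure_exists_forall_pos hB ρ hρ.measurePreserving_reflection
    (fun y => by
      ext d
      change d.1 ⬝ᵥ (m - (y - m) - m) = -(d.1 ⬝ᵥ (y - m))
      rw [← dotProduct_neg]
      congr 1
      abel) T hGP
  set μ := Measure.pi fun _ : Fin T => ρ with hμ
  have hjoint : HasLaw (fun ω t => x t ω) μ P := hindep.hasLaw_pi hlaw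
  have hae : {ω | ∃ u v : Fin N → ℝ, StrictlyDominates (Matrix.of fun i t => x t ω i) u v} =ᵐ[P]
      {ω | ∃ d, ∀ t, 0 < zeroSumReturn m (x t ω) d} := by
    rw [← hjoint.map_eq] at hGP
    filter_upwards [ae_of_ae_map hjoint.aemeasurable hGP] with ω hω
    refine propext ((exists_strictlyDominates_iff hN hm fun t => x t ω).trans
      ⟨fun ⟨d, hd, t, ht⟩ => ?_, fun ⟨d, hd⟩ => ⟨d, fun t => (hd t).le, ⟨0, hT⟩, hd _⟩⟩)
    -- Weak dominance becomes strict in all periods; the strict period ensures d ≠ 0.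
    refine hω.exists_forall_pos (d := d) ?_ hd
    rintro rfl
    simp at ht
  have hmeas : MeasurableSet {X : Fin T → Fin N → ℝ | ∃ d, ∀ t, 0 < zeroSumReturn m (X t) d} := by
    simp only [Set.ofPred_exists, Set.ofPred_forall]
    exact (isOpen_iUnion fun d => isOpen_iInter_of_finite fun t =>
      isOpen_lt continuous_const ((hB d).comp (continuous_apply t))).measurableSet
  rw [measureReal_congr hae, hjoint.measureReal_eq hmeas]
  obtain ⟨n, rfl⟩ := Nat.exists_eq_add_of_le' hN
  obtain ⟨T, rfl⟩ := Nat.exists_eq_add_of_le' hT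
  rw [one_sub_feasibilityProb, eq_div_iff (by positivity), mul_comm]
  have := congrArg ENNReal.toReal hwendel
  rw [finrank_zeroSum] at this
  simpa [Measure.real] using this
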